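/- Let $X\subset\mathbb R^d$, $Y\subset\mathbb R$ and $s\in\mathbb N$, where, if $s>0$, derivatives of functions on $X$ are uniquely determined (e.g. $X$ open). Let $\mathcal H$ be a separable real reproducing kernel Hilbert space of functions on $X$ whose reproducing kernel $K$ is $C^{2s}$ on $X\times X$. For a multi-index $\alpha$ with $|\alpha|\le s$ put $\phi^{(\alpha)}(x)=D^\alpha K(x,\cdot)\in\mathcal H$ (derivative in the first variable) and, for given weights $w_\alpha:X\times Y\to\mathbb R$, $$\psi(z)=\sum_{|\alpha|\le s}w_\alpha(z)\,\phi^{(\alpha)}(x)\in\mathcal H,\qquad z=(x,y)\in X\times Y .$$ Let $z_1,z_2,\dots$ be random observations in $X\times Y$ such that the random vectors $\psi_i=\psi(z_i)$ are i.i.d. in $\mathcal H$ with $\mathbb E\|\psi_1\|_{\mathcal H}^4<\infty$, and let $\lambda>0$. Write $(f\otimes g)u=\langle u,g\rangle f$ and $$\mu=\mathbb E[\psi_1],\quad \Sigma=\mathbb E[(\psi_1-\mu)\otimes(\psi_1-\mu)],\quad \hat\mu=\frac1N\sum_{i=1}^N\psi_i,\quad \hat\Sigma=\frac1N\sum_{i=1}^N(\psi_i-\hat\mu)\otimes(\psi_i-\hat\mu),$$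 $$\tilde\Sigma=\frac1N\sum_{i=1}^N(\psi_i-\mu)\otimes(\psi_i-\mu),\qquad \Sigma_\lambda=\Sigma+\lambda I,\qquad \hat\Sigma_\lambda=\hat\Sigma+\lambda I .$$ Then: (o) $\Sigma_\lambda$ and $\hat\Sigma_\lambda$ are invertible; $h_\lambda:=\Sigma_\lambda^{-1}\mu$ is the unique minimizer over $h\in\mathcal H$ of the regularized mean--variance objective $-\mathbb E\langle h,\psi_1\rangle+\frac12\operatorname{Var}\langle h,\psi_1\rangle+\frac\lambda2\|h\|^2$, and $\hat h_\lambda:=\hat\Sigma_\lambda^{-1}\hat\mu$ is the unique minimizer of the same objective with mean and variance taken under the empirical distribution of $\psi_1,\dots,\psi_N$. (i) $\hat h_\lambda\to h_\lambda$ in $\mathcal H$ almost surely as $N\to\infty$. (ii) $\sqrt N(\hat h_\lambda-h_\lambda)$ converges in distribution in $\mathcal H$ to the centered Gaussian law $\mathcal N_{\mathcal H}(0,\mathcal C_\lambda)$ with covariance operator $\mathcal C_\lambda=\Sigma_\lambda^{-1}\mathcal Q_\lambda\Sigma_\lambda^{-1}$, where $$\mathcal Q_\lambda=\mathbb E[F_1\otimes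 F_1],\qquad F_1=\tilde\psi_1-\tilde{\mathcal C}_1h_\lambda,\qquad \tilde\psi_1=\psi_1-\mu,\qquad \tilde{\mathcal C}_1=\tilde\psi_1\otimes\tilde\psi_1-\Sigma .$$ (iii) $\sqrt N\bigl((\hat\mu-\mu)-(\tilde\Sigma-\Sigma)h_\lambda\bigr)$ converges in distribution in $\mathcal H$ to $\mathcal N_{\mathcal H}(0,\mathcal Q_\lambda)$. -/

import Mathlib

open MeasureTheory ProbabilityTheory InnerProductSpace Filter Topology

noncomputable section

namespace MeanVariance

/-! ### Partial derivatives and the derivative features of a kernel -/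

section Kernel

variable {d : ℕ}

/-- The `i`-th partial derivative of `f` relative to the domain `X ⊆ ℝᵈ`. -/
def partialDeriv (X : Set (EuclideanSpace ℝ (Fin d))) (i : Fin d)
    (f : EuclideanSpace ℝ (Fin d) → ℝ) : EuclideanSpace ℝ (Fin d) → ℝ :=
  fun x => fderivWithin ℝ f X x (EuclideanSpace.single i 1)

/-- The mixed partial derivative `D^α f = ∂₁^{α₁} ⋯ ∂_d^{α_d} f` relative to `X`. -/
def mixedDeriv (X : Set (EuclideanSpace ℝ (Fin d))) (α : Fin d → ℕ)
    (f : EuclideanSpace ℝ (Fin d) → ℝ) : EuclideanSpace ℝ (Fin d) → ℝ :=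
  (List.finRange d).foldr (fun i g => (partialDeriv X i)^[α i] g) f

/-- The multi-indices `α ∈ ℕᵈ` with `|α| ≤ s`. -/
def multiIndices (d s : ℕ) : Finset (Fin d → ℕ) :=
  (Fintype.piFinset fun _ => Finset.range (s + 1)).filter fun α => ∑ i, α i ≤ s

variable {X : Set (EuclideanSpace ℝ (Fin d))} (H : Type*) [NormedAddCommGroup H]
  [InnerProductSpace ℝ H] [RKHS ℝ H X ℝ]

open Classical in
/-- The derivative feature `φ^(α)(x) = D^α K(x, ·)` (derivative in the first argument) as an
element of the space `H` of functions on `X`. It lies in `H` when `K` is sufficiently smooth; the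
value `0` is used if there is no such element. -/
def derivFeature (K : EuclideanSpace ℝ (Fin d) → EuclideanSpace ℝ (Fin d) → ℝ)
    (α : Fin d → ℕ) (x : X) : H :=
  if h : ∃ g : H, ∀ y : X, g y = mixedDeriv X α (fun x' => K x' y) x then h.choose else 0

/-- The representer `ψ(z) = ∑_{|α| ≤ s} w_α(z) φ^(α)(x)`, `z = (x, y)`, of the target functional
`h ↦ ∑_{|α| ≤ s} w_α(z) D^α h(x)`. -/
def psi (s : ℕ) {Y : Set ℝ} (K : EuclideanSpace ℝ (Fin d) → EuclideanSpace ℝ (Fin d) → ℝ)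
    (w : (Fin d → ℕ) → X × Y → ℝ) (z : X × Y) : H :=
  ∑ α ∈ multiIndices d s, w α z • derivFeature H K α z.1

/-- If `D^α K(x, ·)` belongs to `H`, then `derivFeature` is that function. -/
theorem derivFeature_apply {K : EuclideanSpace ℝ (Fin d) → EuclideanSpace ℝ (Fin d) → ℝ}
    {α : Fin d → ℕ} {x : X}
    (h : ∃ g : H, ∀ y : X, g y = mixedDeriv X α (fun x' => K x' y) x) (y : X) :
    derivFeature H K α x y = mixedDeriv X α (fun x' => K x' y) x := by
  unfold derivFeature
  rw [dif_pos h]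
  exact h.choose_spec y

end Kernel

/-! ### Moments, objectives and estimators

`Ψ : ℕ → Ω → H` is the sequence of random vectors `ψ₁, ψ₂, …`, indexed from `0`; the sample of size
`N` consists of `Ψ 0, …, Ψ (N - 1)`. Population quantities are expectations over `Ψ 0`.
The operator `f ⊗ g : u ↦ ⟪u, g⟫ f` is `rankOne ℝ f g`. -/

section Moments

variable {Ω H : Type*} [MeasurableSpace Ω] [NormedAddCommGroup H] [InnerProductSpace ℝ H]

/-- `μ = E[ψ₁]`. -/
def mean (P : Measure Ω) (Ψ : ℕ → Ω → H) : H := ∫ ω, Ψ 0 ω ∂P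

/-- The covariance operator `Σ = E[(ψ₁ - μ) ⊗ (ψ₁ - μ)]`. -/
def cov (P : Measure Ω) (Ψ : ℕ → Ω → H) : H →L[ℝ] H :=
  ∫ ω, rankOne ℝ (Ψ 0 ω - mean P Ψ) (Ψ 0 ω - mean P Ψ) ∂P

/-- The sample mean `μ̂`. -/
def sampleMean (Ψ : ℕ → Ω → H) (N : ℕ) (ω : Ω) : H :=
  (N : ℝ)⁻¹ • ∑ i ∈ Finset.range N, Ψ i ω

/-- The sample covariance operator `Σ̂`, centered at the sample mean. -/
def sampleCov (Ψ : ℕ → Ω → H) (N : ℕ) (ω : Ω) : H →L[ℝ] H :=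
  (N : ℝ)⁻¹ • ∑ i ∈ Finset.range N,
    rankOne ℝ (Ψ i ω - sampleMean Ψ N ω) (Ψ i ω - sampleMean Ψ N ω)

/-- The operator `Σ̃`: the sample covariance operator centered at the population mean. -/
def sampleCovTilde (P : Measure Ω) (Ψ : ℕ → Ω → H) (N : ℕ) (ω : Ω) : H →L[ℝ] H :=
  (N : ℝ)⁻¹ • ∑ i ∈ Finset.range N, rankOne ℝ (Ψ i ω - mean P Ψ) (Ψ i ω - mean P Ψ)

/-- `Σ_λ = Σ + λ I`. -/
def covReg (P : Measure Ω) (Ψ : ℕ → Ω → H) (lam : ℝ) : H →L[ℝ] H :=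
  cov P Ψ + lam • ContinuousLinearMap.id ℝ H

/-- `Σ̂_λ = Σ̂ + λ I`. -/
def sampleCovReg (Ψ : ℕ → Ω → H) (lam : ℝ) (N : ℕ) (ω : Ω) : H →L[ℝ] H :=
  sampleCov Ψ N ω + lam • ContinuousLinearMap.id ℝ H

/-- The regularized population objective
`J_λ(h) = -E⟪h, ψ₁⟫ + (1/2) Var⟪h, ψ₁⟫ + (λ/2) ‖h‖²`. -/
def objective (P : Measure Ω) (Ψ : ℕ → Ω → H) (lam : ℝ) (h : H) : ℝ :=
  -(∫ ω, inner ℝ h (Ψ 0 ω) ∂P) + 1 / 2 * Var[fun ω => inner ℝ h (Ψ 0 ω); P]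
    + lam / 2 * ‖h‖ ^ 2

/-- The regularized empirical objective: mean and variance are those of the values
`⟪h, ψ₁⟫, …, ⟪h, ψ_N⟫` under the empirical distribution. -/
def sampleObjective (Ψ : ℕ → Ω → H) (lam : ℝ) (N : ℕ) (ω : Ω) (h : H) : ℝ :=
  -((N : ℝ)⁻¹ * ∑ i ∈ Finset.range N, inner ℝ h (Ψ i ω))
    + 1 / 2 * ((N : ℝ)⁻¹ * ∑ i ∈ Finset.range N,
        (inner ℝ h (Ψ i ω) - (N : ℝ)⁻¹ * ∑ j ∈ Finset.range N, inner ℝ h (Ψ j ω)) ^ 2)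
    + lam / 2 * ‖h‖ ^ 2

/-- The population solution `h_λ = Σ_λ⁻¹ μ`. -/
def popSol (P : Measure Ω) (Ψ : ℕ → Ω → H) (lam : ℝ) : H :=
  Ring.inverse (covReg P Ψ lam) (mean P Ψ)

/-- The estimator `ĥ_λ = Σ̂_λ⁻¹ μ̂`. -/
def estimator (Ψ : ℕ → Ω → H) (lam : ℝ) (N : ℕ) (ω : Ω) : H :=
  Ring.inverse (sampleCovReg Ψ lam N ω) (sampleMean Ψ N ω)

/-- The random vector `F₁ = ψ̃₁ - C̃₁ h_λ`, where `ψ̃₁ = ψ₁ - μ` and `C̃₁ = ψ̃₁ ⊗ ψ̃₁ - Σ`. -/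
def fluct (P : Measure Ω) (Ψ : ℕ → Ω → H) (lam : ℝ) (ω : Ω) : H :=
  (Ψ 0 ω - mean P Ψ)
    - (rankOne ℝ (Ψ 0 ω - mean P Ψ) (Ψ 0 ω - mean P Ψ) - cov P Ψ) (popSol P Ψ lam)

/-- `Q_λ = E[F₁ ⊗ F₁]`. -/
def covQ (P : Measure Ω) (Ψ : ℕ → Ω → H) (lam : ℝ) : H →L[ℝ] H :=
  ∫ ω, rankOne ℝ (fluct P Ψ lam ω) (fluct P Ψ lam ω) ∂P

/-- `C_λ = Σ_λ⁻¹ Q_λ Σ_λ⁻¹`. -/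
def covLimit (P : Measure Ω) (Ψ : ℕ → Ω → H) (lam : ℝ) : H →L[ℝ] H :=
  Ring.inverse (covReg P Ψ lam) * covQ P Ψ lam * Ring.inverse (covReg P Ψ lam)

end Moments

/-- The sequence `V` of random vectors in the Hilbert space `H` converges in distribution to the
centered Gaussian law `N_H(0, C)` with covariance operator `C`; in particular that law exists. -/
def TendstoGaussian {Ω H : Type*} [MeasurableSpace Ω] [NormedAddCommGroup H]
    [InnerProductSpace ℝ H] [MeasurableSpace H] [BorelSpace H]
    (P : Measure Ω) [IsProbabilityMeasure P] (V : ℕ → Ω → H) (C : H →L[ℝ] H) : Prop :=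
  ∃ (ν : Measure H) (_ : IsGaussian ν),
    ∫ x, x ∂ν = 0 ∧ (∀ u v : H, covarianceBilin ν u v = inner ℝ (C u) v) ∧
      TendstoInDistribution V atTop (fun x : H => x) (fun _ => P) ν

end MeanVariance

end

/-! Write `Σ`, `Σ̂`, `Σ̃`, `μ̂`, `h_λ`, `ĥ_λ` as in the theorem. `Σ` and, for each sample, `Σ̂` are
positive and symmetric, so adding `λ I` makes them coercive with constant `λ`. Hence both inverses
exist with norm at most `1/λ`, and completing the square identifies the minimizers. Consistency is
the strong law for `ψ_i` and for the rank-one operators, together with continuity of inversion at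
units.

For normality put `δ = μ̂ - μ` and `G = δ - (Σ̃ - Σ) h_λ`. Since `Σ̂ = Σ̃ - δ ⊗ δ` and `Σ_λ h_λ =
μ`, there is the exact identity `ĥ_λ - h_λ = Σ̂_λ⁻¹ (G + ⟪δ, h_λ⟫ δ)` (`estimator_sub_popSol`). Here
`√N G` is a normalized sum of centered i.i.d. copies of `F₁`, which is square integrable because
`ψ₁` has a fourth moment; the central limit theorem gives (iii). Replacing `Σ̂_λ⁻¹` by `Σ_λ⁻¹` and
dropping the quadratic term each costs a product of an almost surely null factor and a factor
bounded in `L²`. Slutsky's lemma and the image under the self-adjoint operator `Σ_λ⁻¹` then give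
(ii).

The central limit theorem in `H` combines the scalar one, which yields the limit of the
characteristic functions, with tightness. Tightness rests on `E‖S_n‖² ≤ E‖X‖²` for normalized sums
`S_n`, used for `X` and for the tails `X - P_m X`, whose second moments tend to `0` by dominated
convergence. -/

namespace MeanVariance

/-! ### Compactness and tightness in a Hilbert space through finite-dimensional projections. -/

section Tightness

variable {H : Type*} [NormedAddCommGroup H] [InnerProductSpace ℝ H]

/-- A bounded set that is approximated uniformly well by finite-dimensional projections is compact,
once it is intersected with the conditions expressing this approximation. -/
lemma isCompact_closedBall_inter_projection [CompleteSpace H] (R : ℝ) {r : ℕ → ℝ}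
    (hr : Tendsto r atTop (𝓝 0)) (U : ℕ → Submodule ℝ H) [∀ n, FiniteDimensional ℝ (U n)] :
    IsCompact (Metric.closedBall (0 : H) R ∩ ⋂ n, {x | ‖x - (U n).starProjection x‖ ≤ r n}) := by
  refine TotallyBounded.isCompact_of_isClosed ?_ ?_
  · rw [Metric.totallyBounded_iff]
    intro ε hε
    obtain ⟨n, hn⟩ := (hr.eventually (gt_mem_nhds (half_pos hε))).exists
    -- The projections lie in a compact ball of `U n`, and a finite `ε/2`-net there is an `ε`-net of
    -- the whole set.
    have hc : IsCompact ((↑) '' Metric.closedBall (0 : U n) R : Set H) :=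
      (isCompact_closedBall _ _).image continuous_subtype_val
    obtain ⟨t, ht, hcov⟩ := Metric.totallyBounded_iff.1 hc.totallyBounded (ε / 2) (half_pos hε)
    refine ⟨t, ht, fun x hx => ?_⟩
    have hmem : (U n).starProjection x ∈ ((↑) '' Metric.closedBall (0 : U n) R : Set H) := by
      refine ⟨(U n).orthogonalProjectionOnto x, ?_, rfl⟩
      rw [mem_closedBall_zero_iff]
      exact ((U n).norm_orthogonalProjectionOnto_apply_le x).trans (mem_closedBall_zero_iff.1 hx.1)
    obtain ⟨y, hy, hxy⟩ := Set.mem_iUnion₂.1 (hcov hmem)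
    refine Set.mem_iUnion₂.2 ⟨y, hy, ?_⟩
    have h1 : dist x ((U n).starProjection x) ≤ r n := by
      rw [dist_eq_norm]; exact Set.mem_iInter.1 hx.2 n
    have h2 : dist ((U n).starProjection x) y < ε / 2 := hxy
    rw [Metric.mem_ball]
    linarith [dist_triangle x ((U n).starProjection x) y]
  · refine Metric.isClosed_closedBall.inter (isClosed_iInter fun n => ?_)
    exact isClosed_le (by fun_prop) continuous_const

/-- A set of measures on a Hilbert space is tight if it is uniformly bounded in probability and
uniformly close to finite-dimensional projections in probability. -/
lemma isTightMeasureSet_of_projection [CompleteSpace H] [MeasurableSpace H]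
    {S : Set (Measure H)} (U : ℕ → Submodule ℝ H) [∀ n, FiniteDimensional ℝ (U n)]
    (hbdd : ∀ ε : ENNReal, 0 < ε → ∃ R : ℝ, ∀ μ ∈ S, μ {x | R < ‖x‖} ≤ ε)
    (hproj : ∀ ε : ENNReal, 0 < ε → ∀ r : ℝ, 0 < r →
      ∃ n, ∀ μ ∈ S, μ {x | r < ‖x - (U n).starProjection x‖} ≤ ε) :
    IsTightMeasureSet S := by
  rw [isTightMeasureSet_iff_exists_isCompact_measure_compl_le]
  intro ε hε
  have hε2 : ε / 2 ≠ 0 := (ENNReal.half_pos hε.ne').ne'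
  obtain ⟨R, hR⟩ := hbdd (ε / 2) (ENNReal.half_pos hε.ne')
  -- Half of `ε` pays for boundedness; the other half is spread summably over the levels `j`, each
  -- with tolerance `1/(j+1)`.
  obtain ⟨δ, hδ, hsum⟩ := ENNReal.exists_pos_sum_of_countable hε2 ℕ
  choose n hn using fun j : ℕ => hproj (δ j) (by exact_mod_cast hδ j) (1 / ((j : ℝ) + 1))
    (by positivity)
  refine ⟨_, isCompact_closedBall_inter_projection R tendsto_one_div_add_atTop_nhds_zero_nat
    (fun j => U (n j)), fun μ hμ => ?_⟩
  have hsub : (Metric.closedBall (0 : H) R ∩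
      ⋂ j, {x | ‖x - (U (n j)).starProjection x‖ ≤ 1 / ((j : ℝ) + 1)})ᶜ ⊆
      {x | R < ‖x‖} ∪ ⋃ j : ℕ, {x | 1 / ((j : ℝ) + 1) < ‖x - (U (n j)).starProjection x‖} := by
    intro x hx
    by_contra h
    simp only [Set.mem_union, Set.mem_iUnion, not_or, not_exists, Set.mem_ofPred_eq, not_lt] at h
    exact hx ⟨mem_closedBall_zero_iff.2 h.1, Set.mem_iInter.2 h.2⟩
  calc μ _ ≤ μ ({x | R < ‖x‖} ∪
        ⋃ j : ℕ, {x | 1 / ((j : ℝ) + 1) < ‖x - (U (n j)).starProjection x‖}) := measure_mono hsub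
    _ ≤ ε / 2 + ∑' j, (δ j : ENNReal) := by
      refine (measure_union_le _ _).trans (add_le_add (hR μ hμ) ?_)
      exact (measure_iUnion_le _).trans (ENNReal.tsum_le_tsum fun j => hn j μ hμ)
    _ ≤ ε / 2 + ε / 2 := by gcongr
    _ = ε := ENNReal.add_halves ε

end Tightness

/-! ### Second-moment bounds and operator-valued second moments. -/

section SecondMoment

variable {Ω H : Type*} [MeasurableSpace Ω] {P : Measure Ω} [NormedAddCommGroup H]

/-- Chebyshev's inequality. -/
lemma measure_lt_norm_le [IsFiniteMeasure P] {V : Ω → H} (hV : Integrable (fun ω => ‖V ω‖ ^ 2) P)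
    {C : ℝ} (hC : ∫ ω, ‖V ω‖ ^ 2 ∂P ≤ C) {r : ℝ} (hr : 0 < r) :
    P {ω | r < ‖V ω‖} ≤ ENNReal.ofReal (C / r ^ 2) := by
  have h := mul_meas_ge_le_integral_of_nonneg (.of_forall fun ω => by positivity) hV (r ^ 2)
  have h2 : P.real {ω | r ^ 2 ≤ ‖V ω‖ ^ 2} ≤ C / r ^ 2 := by
    rw [le_div_iff₀ (by positivity)]; linarith
  calc P {ω | r < ‖V ω‖} ≤ P {ω | r ^ 2 ≤ ‖V ω‖ ^ 2} :=
        measure_mono fun ω (hω : r < ‖V ω‖) =>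
          Set.mem_ofPred_eq.symm ▸ pow_le_pow_left₀ hr.le hω.le 2
    _ = ENNReal.ofReal (P.real {ω | r ^ 2 ≤ ‖V ω‖ ^ 2}) := by simp
    _ ≤ _ := ENNReal.ofReal_le_ofReal h2

lemma MemLp.integrable_real_inner [InnerProductSpace ℝ H] {X Y : Ω → H} (hX : MemLp X 2 P)
    (hY : MemLp Y 2 P) : Integrable (fun ω => inner ℝ (X ω) (Y ω)) P :=
  (MemLp.integrable_mul hX.norm hY.norm).mono' (hX.1.inner hY.1)
    (.of_forall fun _ => norm_inner_le_norm _ _)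

lemma continuous_rankOne_self [InnerProductSpace ℝ H] :
    Continuous fun x : H => rankOne ℝ x x :=
  (rankOne ℝ).continuous.clm_apply continuous_id

lemma MemLp.integrable_rankOne_self [InnerProductSpace ℝ H] {X : Ω → H} (hX : MemLp X 2 P) :
    Integrable (fun ω => rankOne ℝ (X ω) (X ω)) P :=
  hX.norm.integrable_sq.mono' (continuous_rankOne_self.comp_aestronglyMeasurable hX.1)
    (.of_forall fun ω => by rw [norm_rankOne, sq])

/-- Reduces operator expectations to scalar second moments, from which symmetry, positivity and the
covariance of the Gaussian limit are read off. -/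
lemma inner_integral_rankOne_self [InnerProductSpace ℝ H] [CompleteSpace H] {X : Ω → H}
    (hX : MemLp X 2 P) (u v : H) :
    inner ℝ ((∫ ω, rankOne ℝ (X ω) (X ω) ∂P) u) v =
      ∫ ω, inner ℝ (X ω) u * inner ℝ (X ω) v ∂P := by
  have hint := MemLp.integrable_rankOne_self hX
  rw [ContinuousLinearMap.integral_apply hint, real_inner_comm,
    ← integral_inner (hint.apply_continuousLinearMap u)]
  refine integral_congr_ae (.of_forall fun ω => ?_)
  simp [real_inner_smul_right, real_inner_comm v]

section

variable [InnerProductSpace ℝ H] [MeasurableSpace H] [BorelSpace H]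

lemma memLp_inv_sqrt_smul_sum {X : ℕ → Ω → H} (hX : MemLp (X 0) 2 P)
    (hident : ∀ i, IdentDistrib (X i) (X 0) P P) (n : ℕ) :
    MemLp (fun ω => (√(n : ℝ))⁻¹ • ∑ k ∈ Finset.range n, X k ω) 2 P :=
  (memLp_finsetSum _ fun i _ => (hident i).memLp_iff.2 hX).const_smul _

variable [CompleteSpace H] [IsProbabilityMeasure P]

/-- The second moment of the normalized sum of centered i.i.d. vectors is at most that of one
summand. -/
lemma integral_norm_sq_inv_sqrt_smul_sum_le {X : ℕ → Ω → H} (hX : MemLp (X 0) 2 P)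
    (h0 : ∫ ω, X 0 ω ∂P = 0) (hindep : iIndepFun X P)
    (hident : ∀ i, IdentDistrib (X i) (X 0) P P) (n : ℕ) :
    ∫ ω, ‖(√(n : ℝ))⁻¹ • ∑ k ∈ Finset.range n, X k ω‖ ^ 2 ∂P ≤ ∫ ω, ‖X 0 ω‖ ^ 2 ∂P := by
  have hL i : MemLp (X i) 2 P := (hident i).memLp_iff.2 hX
  have hint i j : Integrable (fun ω => inner ℝ (X i ω) (X j ω)) P :=
    MemLp.integrable_real_inner (hL i) (hL j)
  have hcross i j (hij : i ≠ j) : ∫ ω, inner ℝ (X i ω) (X j ω) ∂P = 0 := by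
    -- By independence, the expectation of the inner product is the inner product of the
    -- expectations, and these vanish.
    have := (hindep.indepFun hij).integral_bilin
      ((hL i).integrable (by norm_num)) ((hL j).integrable (by norm_num)) (innerSL ℝ)
    refine this.trans ?_
    rw [(hident i).integral_eq, h0, map_zero, zero_apply]
  have hdiag i : ∫ ω, inner ℝ (X i ω) (X i ω) ∂P = ∫ ω, ‖X 0 ω‖ ^ 2 ∂P := by
    simp_rw [real_inner_self_eq_norm_sq]
    exact ((hident i).comp (u := fun x => ‖x‖ ^ 2) (by fun_prop)).integral_eq
  have hexp ω : ‖(√(n : ℝ))⁻¹ • ∑ k ∈ Finset.range n, X k ω‖ ^ 2 =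
      (n : ℝ)⁻¹ * ∑ i ∈ Finset.range n, ∑ j ∈ Finset.range n, inner ℝ (X i ω) (X j ω) := by
    rw [norm_smul, mul_pow, ← real_inner_self_eq_norm_sq (∑ k ∈ Finset.range n, X k ω), sum_inner]
    simp [inner_sum]
  simp_rw [hexp]
  rw [integral_const_mul, integral_finsetSum _ fun i _ => integrable_finsetSum _ fun j _ => hint i j]
  have hrow i (hi : i ∈ Finset.range n) :
      ∫ ω, ∑ j ∈ Finset.range n, inner ℝ (X i ω) (X j ω) ∂P = ∫ ω, ‖X 0 ω‖ ^ 2 ∂P := by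
    rw [integral_finsetSum _ fun j _ => hint i j,
      Finset.sum_eq_single_of_mem i hi fun j _ hji => hcross i j hji.symm, hdiag]
  rw [Finset.sum_congr rfl hrow, Finset.sum_const, Finset.card_range, nsmul_eq_mul, ← mul_assoc]
  -- The factor is `n⁻¹ * n`, which is `1` except for `n = 0`, where it is `0`; hence only an
  -- inequality.
  refine mul_le_of_le_one_left (integral_nonneg fun ω => by positivity) ?_
  exact inv_mul_le_one

end

end SecondMoment

/-! ### The central limit theorem in a separable Hilbert space. -/

section CentralLimit

variable {Ω H : Type*} [MeasurableSpace Ω] {P : Measure Ω} [IsProbabilityMeasure P]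
  [NormedAddCommGroup H] [InnerProductSpace ℝ H] [CompleteSpace H]
  [SecondCountableTopology H] [MeasurableSpace H] [BorelSpace H]

/-- The laws of the normalized sums of centered i.i.d. vectors form a tight set. -/
lemma isTightMeasureSet_inv_sqrt_smul_sum {X : ℕ → Ω → H} (hX : MemLp (X 0) 2 P)
    (h0 : ∫ ω, X 0 ω ∂P = 0) (hindep : iIndepFun X P)
    (hident : ∀ i, IdentDistrib (X i) (X 0) P P) :
    IsTightMeasureSet (Set.range fun n : ℕ =>
      P.map fun ω => (√(n : ℝ))⁻¹ • ∑ k ∈ Finset.range n, X k ω) := by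
  let V : ℕ → Ω → H := fun n ω => (√(n : ℝ))⁻¹ • ∑ k ∈ Finset.range n, X k ω
  have hV n : MemLp (V n) 2 P := memLp_inv_sqrt_smul_sum hX hident n
  -- An increasing sequence of finite-dimensional spaces with dense union, which exists by
  -- separability.
  let U : ℕ → Submodule ℝ H := fun m =>
    Submodule.span ℝ (TopologicalSpace.denseSeq H '' (Set.Iic m))
  have hfin : ∀ m, FiniteDimensional ℝ (U m) := fun m =>
    FiniteDimensional.span_of_finite ℝ ((Set.finite_Iic m).image _)
  have hmono : Monotone U := fun a b hab =>
    Submodule.span_mono (Set.image_mono (Set.Iic_subset_Iic.2 hab))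
  have hdense : ⊤ ≤ (⨆ m, U m).topologicalClosure := by
    have : DenseRange (TopologicalSpace.denseSeq H) := TopologicalSpace.denseRange_denseSeq H
    intro x _
    refine closure_mono ?_ (this x)
    rintro _ ⟨m, rfl⟩
    exact Submodule.mem_iSup_of_mem m (Submodule.subset_span ⟨m, Set.mem_Iic.2 le_rfl, rfl⟩)
  have hproj : Tendsto (fun m => ∫ ω, ‖X 0 ω - (U m).starProjection (X 0 ω)‖ ^ 2 ∂P) atTop
      (𝓝 0) := by
    have := tendsto_integral_of_dominated_convergence (μ := P)
      (F := fun m ω => ‖X 0 ω - (U m).starProjection (X 0 ω)‖ ^ 2) (f := fun _ => (0 : ℝ))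
      (fun ω => ‖X 0 ω‖ ^ 2) (fun m => ?_) ?_ (fun m => ?_) ?_
    · simpa using this
    · have := ((U m).starProjection.continuous.comp_aestronglyMeasurable hX.1)
      exact ((hX.1.sub this).norm.pow 2)
    · exact hX.norm.integrable_sq
    · refine .of_forall fun ω => ?_
      rw [norm_pow, norm_norm]
      gcongr
      rw [← Submodule.starProjection_orthogonal_val]
      exact Submodule.norm_starProjection_apply_le _ _
    · refine .of_forall fun ω => ?_
      have h := Submodule.starProjection_tendsto_self U hmono (X 0 ω) hdense
      simpa using ((tendsto_const_nhds (x := X 0 ω)).sub h).norm.pow 2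
  refine isTightMeasureSet_of_projection U (fun ε hε => ?_) (fun ε hε r hr => ?_)
  · have hlim : Tendsto (fun R : ℝ => ENNReal.ofReal ((∫ ω, ‖X 0 ω‖ ^ 2 ∂P) / R ^ 2)) atTop
        (𝓝 0) := by
      rw [← ENNReal.ofReal_zero]
      exact ENNReal.tendsto_ofReal (tendsto_const_nhds.div_atTop (tendsto_pow_atTop two_ne_zero))
    obtain ⟨R, hR, hRpos⟩ := ((hlim.eventually (gt_mem_nhds hε)).and (eventually_gt_atTop 0)).exists
    refine ⟨R, ?_⟩
    rintro _ ⟨n, rfl⟩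
    rw [Measure.map_apply_of_aemeasurable (hV n).1.aemeasurable
      (measurableSet_lt measurable_const measurable_norm)]
    exact (measure_lt_norm_le (hV n).norm.integrable_sq
      (integral_norm_sq_inv_sqrt_smul_sum_le hX h0 hindep hident n) hRpos).trans hR.le
  · have hlim : Tendsto (fun m => ENNReal.ofReal
        ((∫ ω, ‖X 0 ω - (U m).starProjection (X 0 ω)‖ ^ 2 ∂P) / r ^ 2)) atTop (𝓝 0) := by
      rw [← ENNReal.ofReal_zero]
      exact ENNReal.tendsto_ofReal (by simpa using hproj.div_const (r ^ 2))
    obtain ⟨m, hm⟩ := (hlim.eventually (gt_mem_nhds hε)).exists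
    refine ⟨m, ?_⟩
    rintro _ ⟨n, rfl⟩
    -- The tail map `L = I - P_m` commutes with normalized sums, so the second-moment bound for the
    -- i.i.d. vectors `L X_k` is uniform in `n`.
    let L : H →L[ℝ] H := ContinuousLinearMap.id ℝ H - (U m).starProjection
    have hLm : Measurable L := L.continuous.measurable
    have hLX : MemLp (fun ω => L (X 0 ω)) 2 P := L.comp_memLp' hX
    have hLi : ∀ i, IdentDistrib (fun ω => L (X i ω)) (fun ω => L (X 0 ω)) P P :=
      fun i => (hident i).comp hLm
    have hL0 : ∫ ω, L (X 0 ω) ∂P = 0 := by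
      rw [L.integral_comp_comm (hX.integrable (by norm_num)), h0, map_zero]
    have hLind : iIndepFun (fun i ω => L (X i ω)) P := hindep.comp (fun _ => L) fun _ => hLm
    have hLV n ω : L (V n ω) = (√(n : ℝ))⁻¹ • ∑ k ∈ Finset.range n, L (X k ω) := by
      simp [V, map_sum]
    change P.map (V n) {x | r < ‖L x‖} ≤ ε
    rw [Measure.map_apply_of_aemeasurable (hV n).1.aemeasurable
      (measurableSet_lt measurable_const (L.continuous.norm.measurable))]
    have h2 := integral_norm_sq_inv_sqrt_smul_sum_le hLX hL0 hLind hLi n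
    have h3 := (memLp_inv_sqrt_smul_sum hLX hLi n).norm.integrable_sq
    simp_rw [← hLV] at h2 h3
    exact (measure_lt_norm_le h3 h2 hr).trans hm.le

/-- Pointwise convergence of the characteristic functions of normalized sums. -/
lemma tendsto_charFun_inv_sqrt_smul_sum {X : ℕ → Ω → H} (hX : MemLp (X 0) 2 P)
    (h0 : ∫ ω, X 0 ω ∂P = 0) (hindep : iIndepFun X P)
    (hident : ∀ i, IdentDistrib (X i) (X 0) P P) (u : H) :
    Tendsto (fun n : ℕ =>
      charFun (P.map fun ω => (√(n : ℝ))⁻¹ • ∑ k ∈ Finset.range n, X k ω) u) atTop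
      (𝓝 (Complex.exp (-((∫ ω, inner ℝ (X 0 ω) u ^ 2 ∂P : ℝ) : ℂ) / 2))) := by
  let L : H → ℝ := fun x => inner ℝ x u
  have hLm : Measurable L := by fun_prop
  have hLX : MemLp (fun ω => L (X 0 ω)) 2 P := hX.inner_const u
  have hLi : ∀ i, IdentDistrib (fun ω => L (X i ω)) (fun ω => L (X 0 ω)) P P :=
    fun i => (hident i).comp hLm
  have hL0 : ∫ ω, L (X 0 ω) ∂P = 0 := by
    simp_rw [L, fun ω => real_inner_comm u (X 0 ω)]
    rw [integral_inner (hX.integrable (by norm_num)), h0, inner_zero_right]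
  have hLind : iIndepFun (fun i ω => L (X i ω)) P := hindep.comp (fun _ => L) fun _ => hLm
  have hvar : Var[fun ω => L (X 0 ω); P] = ∫ ω, inner ℝ (X 0 ω) u ^ 2 ∂P := by
    rw [variance_of_integral_eq_zero hLX.1.aemeasurable hL0]
  have hclt := (tendstoInDistribution_inv_sqrt_mul_sum_sub
    (X := fun i ω => L (X i ω)) (HasLaw.id) hLX hLind hLi).tendsto
  -- The characteristic function of `⟪V, u⟫` at `1` is that of `V` at `u`.
  have h1 := ProbabilityMeasure.tendsto_iff_tendsto_charFun.1 hclt 1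
  simp only [ProbabilityMeasure.coe_mk, Measure.map_id, charFun_gaussianReal, hvar, hL0, mul_zero,
    sub_zero] at h1
  rw [Real.coe_toNNReal _ (integral_nonneg fun ω => by positivity)] at h1
  convert h1 using 2 with n
  · have hV := (memLp_inv_sqrt_smul_sum hX hident n).1.aemeasurable
    have hm : (P.map fun ω => (√(n : ℝ))⁻¹ * ∑ k ∈ Finset.range n, L (X k ω)) =
        (P.map fun ω => (√(n : ℝ))⁻¹ • ∑ k ∈ Finset.range n, X k ω).map L := by
      rw [AEMeasurable.map_map_of_aemeasurable hLm.aemeasurable hV]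
      congr 1
      ext ω
      simp [L, sum_inner, inner_smul_left]
    rw [hm, charFun_apply, charFun_apply, integral_map hLm.aemeasurable
      (Measurable.aestronglyMeasurable (by fun_prop))]
    simp [L]
  · simp [neg_div]

/-- Convergence of characteristic functions together with tightness yields convergence in law. -/
lemma exists_tendsto_of_isTightMeasureSet_of_charFun {μ : ℕ → ProbabilityMeasure H}
    (htight : IsTightMeasureSet (Set.range fun n => (μ n : Measure H))) {f : H → ℂ}
    (hf : ∀ u, Tendsto (fun n => charFun (μ n : Measure H) u) atTop (𝓝 (f u))) :
    ∃ ν : ProbabilityMeasure H, charFun (ν : Measure H) = f ∧ Tendsto μ atTop (𝓝 ν) := by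
  -- Prokhorov's theorem supplies a candidate limit along an ultrafilter; its characteristic
  -- function must be `f`.
  have hcomp : IsCompact (closure (Set.range μ)) :=
    isCompact_closure_of_isTightMeasureSet (by simpa [Set.range] using htight)
  obtain ⟨ν, -, hν⟩ := hcomp.ultrafilter_le_nhds ((hyperfilter ℕ).map μ)
    (.trans (by simp) (monotone_principal subset_closure))
  have hν' : Tendsto μ (hyperfilter ℕ : Filter ℕ) (𝓝 ν) := hν
  have hchar : charFun (ν : Measure H) = f := by
    ext u
    rw [ProbabilityMeasure.tendsto_iff_forall_integral_rclike_tendsto ℂ] at hν'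
    refine tendsto_nhds_unique (f := fun n => charFun (μ n : Measure H) u) ?_
      ((hf u).mono_left Nat.hyperfilter_le_atTop)
    simp_rw [charFun_eq_integral_innerProbChar]
    exact hν' (BoundedContinuousFunction.innerProbChar u)
  refine ⟨ν, hchar, ?_⟩
  -- Convergence of the full sequence: trigonometric polynomials separate points, and tightness
  -- makes them sufficient test functions.
  refine ProbabilityMeasure.tendsto_of_tight_of_separatesPoints htight (𝕜 := ℂ)
    (A := BoundedContinuousFunction.charPoly Real.continuous_probChar
      (L := innerₗ H) continuous_inner) ?_ ?_
  · refine BoundedContinuousFunction.separatesPoints_charPoly Real.continuous_probChar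
      Real.probChar_ne_one _ ?_
    exact fun v hv ↦ DFunLike.ne_iff.mpr ⟨v, inner_self_ne_zero.mpr hv⟩
  · exact fun g ↦ ProbabilityMeasure.tendsto_charPoly_of_tendsto_charFun fun u => by
      rw [hchar]; exact hf u

/-- **Central limit theorem in a separable Hilbert space**. -/
theorem tendstoGaussian_inv_sqrt_smul_sum {X : ℕ → Ω → H} (hX : MemLp (X 0) 2 P)
    (h0 : ∫ ω, X 0 ω ∂P = 0) (hindep : iIndepFun X P)
    (hident : ∀ i, IdentDistrib (X i) (X 0) P P) :
    TendstoGaussian P (fun (n : ℕ) ω => (√(n : ℝ))⁻¹ • ∑ k ∈ Finset.range n, X k ω)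
      (∫ ω, rankOne ℝ (X 0 ω) (X 0 ω) ∂P) := by
  set Q : H →L[ℝ] H := ∫ ω, rankOne ℝ (X 0 ω) (X 0 ω) ∂P with hQ
  have hQuv u v : inner ℝ (Q u) v = ∫ ω, inner ℝ (X 0 ω) u * inner ℝ (X 0 ω) v ∂P :=
    inner_integral_rankOne_self hX u v
  have hV n := (memLp_inv_sqrt_smul_sum hX hident n).1.aemeasurable
  obtain ⟨ν, hν, hlim⟩ := exists_tendsto_of_isTightMeasureSet_of_charFun
    (μ := fun n => ⟨P.map fun ω => (√(n : ℝ))⁻¹ • ∑ k ∈ Finset.range n, X k ω,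
      Measure.isProbabilityMeasure_map (hV n)⟩)
    (isTightMeasureSet_inv_sqrt_smul_sum hX h0 hindep hident)
    (tendsto_charFun_inv_sqrt_smul_sum hX h0 hindep hident)
  let f : H →L[ℝ] H →L[ℝ] ℝ := innerSL ℝ ∘L Q
  have hf u v : f u v = ∫ ω, inner ℝ (X 0 ω) u * inner ℝ (X 0 ω) v ∂P := hQuv u v
  have hpos : f.toBilinForm.IsPosSemidef := by
    refine ⟨⟨fun x y => ?_⟩, ⟨fun x => ?_⟩⟩
    · simp [hf, mul_comm]
    · have : 0 ≤ f x x := by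
        rw [hf]; exact integral_nonneg fun ω => mul_self_nonneg _
      simpa using this
  have hchar t : charFun (ν : Measure H) t =
      Complex.exp (inner ℝ t (0 : H) * Complex.I - f t t / 2) := by
    rw [hν]
    simp [hf, sq, neg_div]
  obtain ⟨hm, hcov⟩ := gaussian_charFun_congr 0 f hpos hchar
  refine ⟨ν, isGaussian_iff_gaussian_charFun.2 ⟨0, f, hpos, hchar⟩, hm.symm, fun u v => ?_,
    hV, measurable_id.aemeasurable, ?_⟩
  · rw [← hcov]; exact (hf u v).trans (hQuv u v).symm
  · have hid : (ν : Measure H).map (fun x : H => x) = ν := Measure.map_id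
    have hlaw : ν = ⟨(ν : Measure H).map (fun x : H => x),
        Measure.isProbabilityMeasure_map measurable_id.aemeasurable⟩ := Subtype.ext hid.symm
    exact hlaw ▸ hlim

end CentralLimit

/-! ### Coercive operators and quadratic minimization. -/

section Coercive

variable {H : Type*} [NormedAddCommGroup H] [InnerProductSpace ℝ H] {A : H →L[ℝ] H} {lam : ℝ}

lemma isUnit_of_coercive [CompleteSpace H] (hlam : 0 < lam)
    (hA : ∀ u, lam * ‖u‖ ^ 2 ≤ inner ℝ (A u) u) : IsUnit A := by
  refine ContinuousLinearMap.isUnit_of_forall_le_norm_inner_map A (c := ⟨lam, hlam.le⟩) hlam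
    fun x => ?_
  rw [mul_comm]
  exact (hA x).trans (le_abs_self _)

/-- Coercivity and Cauchy–Schwarz give `λ ‖y‖ ≤ ‖A y‖`. The bound depends on `λ` alone, hence is
uniform over all samples. -/
lemma norm_inverse_le_of_coercive [CompleteSpace H] (hlam : 0 < lam)
    (hA : ∀ u, lam * ‖u‖ ^ 2 ≤ inner ℝ (A u) u) : ‖Ring.inverse A‖ ≤ lam⁻¹ := by
  refine ContinuousLinearMap.opNorm_le_bound _ (by positivity) fun x => ?_
  have hx : A (Ring.inverse A x) = x :=
    congrArg (· x) (Ring.mul_inverse_cancel A (isUnit_of_coercive hlam hA))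
  set y := Ring.inverse A x
  have h1 : lam * ‖y‖ ^ 2 ≤ ‖x‖ * ‖y‖ := by
    have := (hA y).trans (real_inner_le_norm _ _)
    rwa [hx] at this
  rw [inv_mul_eq_div, le_div_iff₀ hlam]
  rcases (norm_nonneg y).eq_or_lt with h | h
  · rw [← h, zero_mul]; exact norm_nonneg x
  · nlinarith

/-- The unique minimizer of a coercive quadratic functional. -/
lemma isMinOn_iff_eq_inverse [CompleteSpace H] (hlam : 0 < lam)
    (hsymm : ∀ u v, inner ℝ (A u) v = inner ℝ (A v) u)
    (hA : ∀ u, lam * ‖u‖ ^ 2 ≤ inner ℝ (A u) u) {b : H} {J : H → ℝ}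
    (hJ : ∀ h, J h = -inner ℝ h b + 1 / 2 * inner ℝ (A h) h) (g : H) :
    IsMinOn J Set.univ g ↔ g = Ring.inverse A b := by
  have hb : A (Ring.inverse A b) = b :=
    congrArg (· b) (Ring.mul_inverse_cancel A (isUnit_of_coercive hlam hA))
  set h₀ := Ring.inverse A b
  -- Completing the square: symmetry and `A h₀ = b` cancel the linear term.
  have hdiff h : J h = J h₀ + 1 / 2 * inner ℝ (A (h - h₀)) (h - h₀) := by
    rw [hJ, hJ, map_sub, inner_sub_left, inner_sub_right, inner_sub_right, hsymm h h₀, hb,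
      real_inner_comm h b, real_inner_comm h₀ b]
    ring
  constructor
  · intro hg
    have h1 : J g ≤ J h₀ := isMinOn_iff.1 hg h₀ (Set.mem_univ _)
    have h2 := hA (g - h₀)
    have h3 : ‖g - h₀‖ ^ 2 ≤ 0 := by
      by_contra hc
      have := mul_pos hlam (not_le.1 hc)
      linarith [hdiff g]
    exact sub_eq_zero.1 (norm_eq_zero.1 (pow_eq_zero_iff two_ne_zero |>.1
      (le_antisymm h3 (by positivity))))
  · rintro rfl
    refine isMinOn_iff.2 fun h _ => ?_
    have h2 := hA (h - h₀)
    have h3 : 0 ≤ lam * ‖h - h₀‖ ^ 2 := by positivity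
    linarith [hdiff h]

end Coercive

/-! ### Coercivity of the regularized covariances and the variational characterizations. -/

section Operators

variable {Ω H : Type*} [NormedAddCommGroup H] [InnerProductSpace ℝ H] {lam : ℝ}

lemma inner_add_smul_id (S : H →L[ℝ] H) (lam : ℝ) (u v : H) :
    inner ℝ ((S + lam • ContinuousLinearMap.id ℝ H) u) v = inner ℝ (S u) v + lam * inner ℝ u v := by
  simp [inner_add_left, real_inner_smul_left]

lemma inner_sampleCov (Ψ : ℕ → Ω → H) (N : ℕ) (ω : Ω) (u v : H) :
    inner ℝ (sampleCov Ψ N ω u) v = (N : ℝ)⁻¹ * ∑ i ∈ Finset.range N,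
      inner ℝ (Ψ i ω - sampleMean Ψ N ω) u * inner ℝ (Ψ i ω - sampleMean Ψ N ω) v := by
  rw [sampleCov, smul_apply, real_inner_smul_left, sum_apply, sum_inner]
  simp_rw [rankOne_apply, real_inner_smul_left]

lemma sampleCovReg_coercive (Ψ : ℕ → Ω → H) (lam : ℝ) (N : ℕ) (ω : Ω) (u : H) :
    lam * ‖u‖ ^ 2 ≤ inner ℝ (sampleCovReg Ψ lam N ω u) u := by
  rw [sampleCovReg, inner_add_smul_id, inner_sampleCov, real_inner_self_eq_norm_sq]
  have : 0 ≤ (N : ℝ)⁻¹ * ∑ i ∈ Finset.range N,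
      inner ℝ (Ψ i ω - sampleMean Ψ N ω) u * inner ℝ (Ψ i ω - sampleMean Ψ N ω) u :=
    mul_nonneg (by positivity) (Finset.sum_nonneg fun i _ => mul_self_nonneg _)
  linarith

lemma sampleCovReg_symm (Ψ : ℕ → Ω → H) (lam : ℝ) (N : ℕ) (ω : Ω) (u v : H) :
    inner ℝ (sampleCovReg Ψ lam N ω u) v = inner ℝ (sampleCovReg Ψ lam N ω v) u := by
  simp_rw [sampleCovReg, inner_add_smul_id, inner_sampleCov, real_inner_comm u v,
    mul_comm (inner ℝ _ u)]

variable [CompleteSpace H]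

/-- The empirical objective is minimized exactly by the estimator. -/
lemma isMinOn_sampleObjective_iff (Ψ : ℕ → Ω → H) (hlam : 0 < lam) (N : ℕ) (ω : Ω) (g : H) :
    IsMinOn (sampleObjective Ψ lam N ω) Set.univ g ↔ g = estimator Ψ lam N ω := by
  refine isMinOn_iff_eq_inverse hlam (sampleCovReg_symm Ψ lam N ω)
    (sampleCovReg_coercive Ψ lam N ω) (fun h => ?_) g
  have hmean : (N : ℝ)⁻¹ * ∑ i ∈ Finset.range N, inner ℝ h (Ψ i ω) =
      inner ℝ h (sampleMean Ψ N ω) := by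
    rw [sampleMean, real_inner_smul_right, inner_sum]
  rw [sampleObjective, hmean, sampleCovReg, inner_add_smul_id, inner_sampleCov,
    real_inner_self_eq_norm_sq]
  simp_rw [← inner_sub_right, ← sq, real_inner_comm h]
  ring

variable [MeasurableSpace Ω] {P : Measure Ω} [IsProbabilityMeasure P] {Ψ : ℕ → Ω → H}

lemma inner_cov (hΨ : MemLp (Ψ 0) 2 P) (u v : H) :
    inner ℝ (cov P Ψ u) v =
      ∫ ω, inner ℝ (Ψ 0 ω - mean P Ψ) u * inner ℝ (Ψ 0 ω - mean P Ψ) v ∂P :=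
  inner_integral_rankOne_self (hΨ.sub (memLp_const _)) u v

lemma covReg_coercive (hΨ : MemLp (Ψ 0) 2 P) (lam : ℝ) (u : H) :
    lam * ‖u‖ ^ 2 ≤ inner ℝ (covReg P Ψ lam u) u := by
  rw [covReg, inner_add_smul_id, inner_cov hΨ, real_inner_self_eq_norm_sq]
  have : 0 ≤ ∫ ω, inner ℝ (Ψ 0 ω - mean P Ψ) u * inner ℝ (Ψ 0 ω - mean P Ψ) u ∂P :=
    integral_nonneg fun ω => mul_self_nonneg _
  linarith

lemma covReg_symm (hΨ : MemLp (Ψ 0) 2 P) (lam : ℝ) (u v : H) :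
    inner ℝ (covReg P Ψ lam u) v = inner ℝ (covReg P Ψ lam v) u := by
  simp_rw [covReg, inner_add_smul_id, inner_cov hΨ, real_inner_comm u v,
    mul_comm (inner ℝ _ u)]

/-- The population objective is minimized exactly by the population solution. -/
lemma isMinOn_objective_iff (hΨ : MemLp (Ψ 0) 2 P) (hlam : 0 < lam) (g : H) :
    IsMinOn (objective P Ψ lam) Set.univ g ↔ g = popSol P Ψ lam := by
  refine isMinOn_iff_eq_inverse hlam (covReg_symm hΨ lam) (covReg_coercive hΨ lam)
    (fun h => ?_) g
  have hmean : ∫ ω, inner ℝ h (Ψ 0 ω) ∂P = inner ℝ h (mean P Ψ) :=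
    integral_inner (hΨ.integrable (by norm_num)) h
  rw [objective, variance_eq_integral (hΨ.const_inner h).1.aemeasurable, hmean, covReg,
    inner_add_smul_id, inner_cov hΨ, real_inner_self_eq_norm_sq]
  simp_rw [← inner_sub_right, ← sq, real_inner_comm h]
  ring

end Operators

/-! ### Strong laws and almost sure convergence. -/

section Consistency

lemma sampleMean_sub {Ω H : Type*} [NormedAddCommGroup H] [InnerProductSpace ℝ H] {N : ℕ} (hN : N ≠ 0) (Ψ : ℕ → Ω → H) (c : H) (ω : Ω) :
    sampleMean Ψ N ω - c = (N : ℝ)⁻¹ • ∑ i ∈ Finset.range N, (Ψ i ω - c) := by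
  have : (N : ℝ) ≠ 0 := Nat.cast_ne_zero.2 hN
  rw [sampleMean, Finset.sum_sub_distrib, smul_sub, Finset.sum_const, Finset.card_range,
    ← Nat.cast_smul_eq_nsmul ℝ, inv_smul_smul₀ this]

variable {Ω H : Type*} [MeasurableSpace Ω] [NormedAddCommGroup H] [InnerProductSpace ℝ H]
  {P : Measure Ω} {Ψ : ℕ → Ω → H} {lam : ℝ}

/-- The covariance operator centered at the sample mean differs from the one centered at the
population mean by a rank-one correction. -/
lemma sampleCov_eq {N : ℕ} (hN : N ≠ 0) (P : Measure Ω) (Ψ : ℕ → Ω → H) (ω : Ω) :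
    sampleCov Ψ N ω = sampleCovTilde P Ψ N ω -
      rankOne ℝ (sampleMean Ψ N ω - mean P Ψ) (sampleMean Ψ N ω - mean P Ψ) := by
  have hN' : (N : ℝ) ≠ 0 := Nat.cast_ne_zero.2 hN
  set δ := sampleMean Ψ N ω - mean P Ψ with hδ
  have hsum : ∑ i ∈ Finset.range N, (Ψ i ω - mean P Ψ) = (N : ℝ) • δ := by
    rw [hδ, sampleMean_sub hN, smul_inv_smul₀ hN']
  -- After summation each of the two cross terms contributes `-N δ ⊗ δ` and the last term `+N δ ⊗
  -- δ`, so one negative copy remains.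
  have hterm i : rankOne ℝ (Ψ i ω - sampleMean Ψ N ω) (Ψ i ω - sampleMean Ψ N ω) =
      rankOne ℝ (Ψ i ω - mean P Ψ) (Ψ i ω - mean P Ψ) - rankOne ℝ (Ψ i ω - mean P Ψ) δ
        - rankOne ℝ δ (Ψ i ω - mean P Ψ) + rankOne ℝ δ δ := by
    have : Ψ i ω - sampleMean Ψ N ω = (Ψ i ω - mean P Ψ) - δ := by rw [hδ]; abel
    ext x
    simp only [this, rankOne_apply, sub_apply, add_apply, inner_sub_left, sub_smul, smul_sub]
    abel
  have h1 : ∑ i ∈ Finset.range N, rankOne ℝ (Ψ i ω - mean P Ψ) δ = (N : ℝ) • rankOne ℝ δ δ := by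
    ext x
    simp_rw [sum_apply, smul_apply, rankOne_apply, ← Finset.smul_sum, hsum]
    exact smul_comm _ _ _
  have h2 : ∑ i ∈ Finset.range N, rankOne ℝ δ (Ψ i ω - mean P Ψ) = (N : ℝ) • rankOne ℝ δ δ := by
    rw [← map_sum, hsum]; simp
  rw [sampleCov, sampleCovTilde, Finset.sum_congr rfl fun i _ => hterm i, Finset.sum_add_distrib,
    Finset.sum_sub_distrib, Finset.sum_sub_distrib, h1, h2, Finset.sum_const, Finset.card_range,
    ← Nat.cast_smul_eq_nsmul ℝ, sub_add_cancel, smul_sub, inv_smul_smul₀ hN']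

variable [CompleteSpace H] [MeasurableSpace H] [BorelSpace H] [IsProbabilityMeasure P]

lemma tendsto_sampleMean (hΨ : MemLp (Ψ 0) 2 P) (hindep : iIndepFun Ψ P)
    (hident : ∀ i, IdentDistrib (Ψ i) (Ψ 0) P P) :
    ∀ᵐ ω ∂P, Tendsto (fun N => sampleMean Ψ N ω) atTop (𝓝 (mean P Ψ)) :=
  strong_law_ae Ψ (hΨ.integrable (by norm_num)) (fun _ _ hij => hindep.indepFun hij) hident

/-- The strong law in the Banach space of operators handles the version centered at `μ`; the
rank-one correction vanishes because `μ̂ → μ`. -/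
lemma tendsto_sampleCov (hΨ : MemLp (Ψ 0) 2 P) (hindep : iIndepFun Ψ P)
    (hident : ∀ i, IdentDistrib (Ψ i) (Ψ 0) P P) :
    ∀ᵐ ω ∂P, Tendsto (fun N => sampleCov Ψ N ω) atTop (𝓝 (cov P Ψ)) := by
  have hm : Measurable fun x : H => rankOne ℝ (x - mean P Ψ) (x - mean P Ψ) :=
    (continuous_rankOne_self.comp (continuous_sub_right _)).measurable
  have htilde := strong_law_ae (fun i ω => rankOne ℝ (Ψ i ω - mean P Ψ) (Ψ i ω - mean P Ψ))
    (MemLp.integrable_rankOne_self (hΨ.sub (memLp_const _)))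
    (fun _ _ hij => (hindep.indepFun hij).comp hm hm) (fun i => (hident i).comp hm)
  filter_upwards [htilde, tendsto_sampleMean hΨ hindep hident] with ω h1 h2
  have h3 := h1.sub ((continuous_rankOne_self.tendsto _).comp (h2.sub_const (mean P Ψ)))
  rw [sub_self, map_zero, sub_zero] at h3
  refine h3.congr' ?_
  filter_upwards [eventually_ne_atTop 0] with N hN
  rw [sampleCov_eq hN P]
  rfl

/-- Strong consistency of the estimator. -/
lemma tendsto_estimator (hΨ : MemLp (Ψ 0) 2 P) (hindep : iIndepFun Ψ P)
    (hident : ∀ i, IdentDistrib (Ψ i) (Ψ 0) P P) (hlam : 0 < lam) :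
    ∀ᵐ ω ∂P, Tendsto (fun N => estimator Ψ lam N ω) atTop (𝓝 (popSol P Ψ lam)) := by
  filter_upwards [tendsto_sampleMean hΨ hindep hident, tendsto_sampleCov hΨ hindep hident]
    with ω h1 h2
  obtain ⟨a, ha⟩ := isUnit_of_coercive hlam (covReg_coercive hΨ lam)
  have h3 := NormedRing.inverse_continuousAt a
  rw [ha] at h3
  exact (isBoundedBilinearMap_apply.continuous.tendsto (_, _)).comp
    ((h3.tendsto.comp (h2.add_const _)).prodMk_nhds h1)

end Consistency

/-! ### Measurability of the estimator and the sample moments. -/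

section Measurability

variable {Ω H : Type*} [NormedAddCommGroup H] [InnerProductSpace ℝ H] {lam : ℝ}

/-- The estimator depends continuously on the sample. -/
lemma continuous_estimator [CompleteSpace H] (hlam : 0 < lam) (N : ℕ) :
    Continuous fun x : ℕ → H => estimator (fun i (x : ℕ → H) => x i) lam N x := by
  have hmean : Continuous fun x : ℕ → H => sampleMean (fun i (x : ℕ → H) => x i) N x := by
    unfold sampleMean; fun_prop
  have hcov : Continuous fun x : ℕ → H => sampleCovReg (fun i (x : ℕ → H) => x i) lam N x := by
    unfold sampleCovReg sampleCov
    refine Continuous.add (.fun_const_smul (continuous_finsetSum _ fun i _ => ?_) _)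
      continuous_const
    exact continuous_rankOne_self.comp ((continuous_apply i).sub hmean)
  -- Coercivity holds for every sample, so inversion is continuous at every operator that occurs.
  refine Continuous.clm_apply (f := fun x : ℕ → H =>
    Ring.inverse (sampleCovReg (fun i (x : ℕ → H) => x i) lam N x)) (continuous_iff_continuousAt.2 fun x => ?_) hmean
  obtain ⟨a, ha⟩ := isUnit_of_coercive hlam
    (sampleCovReg_coercive (fun i (x : ℕ → H) => x i) lam N x)
  have h := NormedRing.inverse_continuousAt a
  rw [ha] at h
  exact h.comp hcov.continuousAt

variable [MeasurableSpace Ω] {P : Measure Ω} {Ψ : ℕ → Ω → H} [MeasurableSpace H] [BorelSpace H]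
  [SecondCountableTopology H]

lemma aemeasurable_estimator [CompleteSpace H] (hΨ : ∀ i, AEMeasurable (Ψ i) P) (hlam : 0 < lam)
    (N : ℕ) : AEMeasurable (fun ω => estimator Ψ lam N ω) P :=
  (continuous_estimator hlam N).measurable.comp_aemeasurable (aemeasurable_pi_iff.2 hΨ)

lemma aemeasurable_sampleMean (hΨ : ∀ i, AEMeasurable (Ψ i) P) (N : ℕ) :
    AEMeasurable (fun ω => sampleMean Ψ N ω) P :=
  (Finset.aemeasurable_fun_sum _ fun i _ => hΨ i).const_smul (N : ℝ)⁻¹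

lemma aestronglyMeasurable_sampleCov (hΨ : ∀ i, AEMeasurable (Ψ i) P) (N : ℕ) :
    AEStronglyMeasurable (fun ω => sampleCov Ψ N ω) P := by
  refine AEStronglyMeasurable.const_smul
    (Finset.aestronglyMeasurable_fun_sum (Finset.range N) fun i _ => ?_) (N : ℝ)⁻¹
  exact continuous_rankOne_self.comp_aestronglyMeasurable
    ((hΨ i).sub (aemeasurable_sampleMean hΨ N)).aestronglyMeasurable

end Measurability

/-! ### Negligible remainders and stability of Gaussian limits. -/

section Slutsky

lemma tendstoInMeasure_zero_add {Ω H : Type*} [MeasurableSpace Ω] {P : Measure Ω}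
    [NormedAddCommGroup H] {D E : ℕ → Ω → H} (hD : TendstoInMeasure P D atTop 0)
    (hE : TendstoInMeasure P E atTop 0) : TendstoInMeasure P (D + E) atTop 0 := by
  rw [tendstoInMeasure_iff_norm] at *
  intro ε hε
  have h := (hD (ε / 2) (half_pos hε)).add (hE (ε / 2) (half_pos hε))
  rw [add_zero] at h
  refine tendsto_of_tendsto_of_tendsto_of_le_of_le tendsto_const_nhds h (fun _ => zero_le)
    fun N => (measure_mono fun ω hω => ?_).trans (measure_union_le _ _)
  by_contra hc
  simp only [Set.mem_union, Set.mem_ofPred_eq, not_or, not_le, Pi.zero_apply, Pi.add_apply,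
    sub_zero] at hω hc
  linarith [norm_add_le (D N ω) (E N ω)]

variable {Ω H : Type*} [MeasurableSpace Ω] {P : Measure Ω} [IsProbabilityMeasure P]
  [NormedAddCommGroup H]

/-- A sequence dominated by the product of a null sequence and a sequence bounded in `L²` tends to
zero in probability. -/
lemma tendstoInMeasure_zero_of_le_mul {D V : ℕ → Ω → H} {Z : ℕ → Ω → ℝ}
    (hZm : ∀ N, AEStronglyMeasurable (Z N) P)
    (hZ : ∀ᵐ ω ∂P, Tendsto (fun N => Z N ω) atTop (𝓝 0))
    (hV : ∀ N, Integrable (fun ω => ‖V N ω‖ ^ 2) P) {C : ℝ}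
    (hC : ∀ N, ∫ ω, ‖V N ω‖ ^ 2 ∂P ≤ C)
    (hD : ∀ N ω, ‖D N ω‖ ≤ Z N ω * ‖V N ω‖) :
    TendstoInMeasure P D atTop 0 := by
  rw [tendstoInMeasure_iff_norm]
  intro ε hε
  have hZP := tendstoInMeasure_iff_norm.1 (tendstoInMeasure_of_tendsto_ae hZm hZ)
  rw [ENNReal.tendsto_nhds_zero]
  intro η hη
  have hlim : Tendsto (fun R : ℝ => ENNReal.ofReal (C / R ^ 2)) atTop (𝓝 0) := by
    rw [← ENNReal.ofReal_zero]
    exact ENNReal.tendsto_ofReal (tendsto_const_nhds.div_atTop (tendsto_pow_atTop two_ne_zero))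
  -- `R` bounds `V N` outside probability `η/2` for all `N` at once; then `‖D N‖ ≥ ε` forces `|Z N|
  -- ≥ ε / R`.
  obtain ⟨R, hR, hRpos⟩ := ((hlim.eventually (gt_mem_nhds (ENNReal.half_pos hη.ne'))).and
    (eventually_gt_atTop 0)).exists
  filter_upwards [(hZP (ε / R) (by positivity)).eventually
    (gt_mem_nhds (ENNReal.half_pos hη.ne'))] with N hZN
  have hsub : {ω | ε ≤ ‖D N ω - (0 : Ω → H) ω‖} ⊆
      {ω | ε / R ≤ ‖Z N ω - 0‖} ∪ {ω | R < ‖V N ω‖} := by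
    intro ω hω
    by_contra hc
    simp only [Set.mem_union, Set.mem_ofPred_eq, not_or, not_le, not_lt, Pi.zero_apply, sub_zero,
      Real.norm_eq_abs] at hω hc
    have h1 := hD N ω
    have h2 : Z N ω * ‖V N ω‖ ≤ |Z N ω| * R :=
      mul_le_mul (le_abs_self _) hc.2 (norm_nonneg _) (abs_nonneg _)
    have h3 := (lt_div_iff₀ hRpos).1 hc.1
    linarith
  calc _ ≤ _ := measure_mono hsub
    _ ≤ η / 2 + η / 2 := (measure_union_le _ _).trans
      (add_le_add hZN.le ((measure_lt_norm_le (hV N) (hC N) hRpos).trans hR.le))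
    _ = η := ENNReal.add_halves η

lemma TendstoGaussian.of_tendstoInMeasure_sub [InnerProductSpace ℝ H] [MeasurableSpace H]
    [BorelSpace H] [SecondCountableTopology H] {V W : ℕ → Ω → H} {C : H →L[ℝ] H}
    (hV : TendstoGaussian P V C) (hWV : TendstoInMeasure P (W - V) atTop 0)
    (hW : ∀ N, AEMeasurable (W N) P) : TendstoGaussian P W C := by
  obtain ⟨ν, hν, hmean, hcov, hlim⟩ := hV
  exact ⟨ν, hν, hmean, hcov, tendstoInDistribution_of_tendstoInMeasure_sub W _ hlim hWV hW⟩

/-- Convergence to a Gaussian law is preserved by continuous linear maps. -/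
lemma TendstoGaussian.clm_comp [InnerProductSpace ℝ H] [CompleteSpace H] [MeasurableSpace H]
    [BorelSpace H] [SecondCountableTopology H] {V : ℕ → Ω → H} {C : H →L[ℝ] H}
    (hV : TendstoGaussian P V C) (A : H →L[ℝ] H) :
    TendstoGaussian P (fun N ω => A (V N ω)) (A * C * A.adjoint) := by
  obtain ⟨ν, hν, hmean, hcov, hlim⟩ := hV
  have hA : Measurable A := A.continuous.measurable
  refine ⟨ν.map A, inferInstance, ?_, fun u v => ?_, ?_⟩
  · rw [integral_map hA.aemeasurable (by fun_prop),
      A.integral_comp_comm (φ := fun x : H => x) IsGaussian.integrable_id, hmean, map_zero]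
  · rw [covarianceBilin_map IsGaussian.memLp_two_id, hcov]
    simp [ContinuousLinearMap.adjoint_inner_right]
  · have h := hlim.continuous_comp A.continuous
    refine ⟨h.forall_aemeasurable, measurable_id.aemeasurable, ?_⟩
    have hid : (ν.map A).map (fun x : H => x) = ν.map (A ∘ fun x => x) := Measure.map_id
    have hlaw : (⟨(ν.map A).map (fun x : H => x), Measure.isProbabilityMeasure_map
        measurable_id.aemeasurable⟩ : ProbabilityMeasure H) =
        ⟨ν.map (A ∘ fun x => x), Measure.isProbabilityMeasure_map h.aemeasurable_limit⟩ :=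
      Subtype.ext hid
    rw [hlaw]
    exact h.tendsto

end Slutsky

/-! ### The central limit theorem for the linear fluctuation term. -/

section Fluctuation

/-- The vector is `⟪X, h⟫ X`, a product of two `L⁴` factors, so Hölder applies. This is where the
fourth moment enters. -/
lemma memLp_rankOne_self_apply {Ω H : Type*} [MeasurableSpace Ω]
    {P : Measure Ω} [NormedAddCommGroup H] [InnerProductSpace ℝ H] {X : Ω → H} (hX : MemLp X 4 P) (h : H) :
    MemLp (fun ω => rankOne ℝ (X ω) (X ω) h) 2 P := by
  have : ENNReal.HolderTriple 4 4 2 := ⟨by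
    rw [← two_mul, show (4 : ENNReal) = 2 * 2 by norm_num,
      ENNReal.mul_inv (by norm_num) (by norm_num), ← mul_assoc,
      ENNReal.mul_inv_cancel (by norm_num) (by norm_num), one_mul]⟩
  exact MemLp.smul (r := 2) hX (hX.inner_const h)

variable {Ω H : Type*} [MeasurableSpace Ω] {P : Measure Ω} [IsProbabilityMeasure P]
  [NormedAddCommGroup H] [InnerProductSpace ℝ H] [CompleteSpace H]
  [SecondCountableTopology H] [MeasurableSpace H] [BorelSpace H] {Ψ : ℕ → Ω → H}

/-- The normalized fluctuation satisfies the central limit theorem. -/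
lemma tendstoGaussian_fluct (hΨ : MemLp (Ψ 0) 4 P) (hindep : iIndepFun Ψ P)
    (hident : ∀ i, IdentDistrib (Ψ i) (Ψ 0) P P) (lam : ℝ) :
    (∀ N : ℕ, Integrable (fun ω => ‖√(N : ℝ) • ((sampleMean Ψ N ω - mean P Ψ)
        - (sampleCovTilde P Ψ N ω - cov P Ψ) (popSol P Ψ lam))‖ ^ 2) P ∧
      ∫ ω, ‖√(N : ℝ) • ((sampleMean Ψ N ω - mean P Ψ)
        - (sampleCovTilde P Ψ N ω - cov P Ψ) (popSol P Ψ lam))‖ ^ 2 ∂P ≤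
        ∫ ω, ‖fluct P Ψ lam ω‖ ^ 2 ∂P) ∧
    TendstoGaussian P (fun (N : ℕ) ω => √(N : ℝ) • ((sampleMean Ψ N ω - mean P Ψ)
        - (sampleCovTilde P Ψ N ω - cov P Ψ) (popSol P Ψ lam))) (covQ P Ψ lam) := by
  set h := popSol P Ψ lam
  -- `g` makes the fluctuation a function of one observation, so `g (Ψ k)` inherits independence and
  -- identical distribution.
  let g : H → H := fun x => (x - mean P Ψ)
    - (rankOne ℝ (x - mean P Ψ) (x - mean P Ψ) - cov P Ψ) h
  have hg : Measurable g := by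
    refine Continuous.measurable ?_
    refine (continuous_sub_right _).sub (Continuous.clm_apply ?_ continuous_const)
    exact (continuous_rankOne_self.comp (continuous_sub_right _)).sub continuous_const
  have hL2 : MemLp (Ψ 0) 2 P := hΨ.mono_exponent (by norm_num)
  have hc4 : MemLp (fun ω => Ψ 0 ω - mean P Ψ) 4 P := hΨ.sub (memLp_const _)
  have hc2 : MemLp (fun ω => Ψ 0 ω - mean P Ψ) 2 P := hL2.sub (memLp_const _)
  have hX : MemLp (fun ω => g (Ψ 0 ω)) 2 P :=
    hc2.sub ((memLp_rankOne_self_apply hc4 h).sub (memLp_const _))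
  have hint : Integrable (fun ω => rankOne ℝ (Ψ 0 ω - mean P Ψ) (Ψ 0 ω - mean P Ψ)) P :=
    MemLp.integrable_rankOne_self hc2
  have h0 : ∫ ω, g (Ψ 0 ω) ∂P = 0 := by
    have h1 : ∫ ω, (Ψ 0 ω - mean P Ψ) ∂P = 0 := by
      rw [integral_sub (hL2.integrable (by norm_num)) (integrable_const _)]
      simp [mean]
    have h2 : ∫ ω, (rankOne ℝ (Ψ 0 ω - mean P Ψ) (Ψ 0 ω - mean P Ψ) - cov P Ψ) h ∂P = 0 := by
      refine (ContinuousLinearMap.integral_apply (hint.sub (integrable_const (cov P Ψ))) h).symm.trans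
        ?_
      rw [integral_sub' hint (integrable_const _)]
      simp [cov]
    have h3 := integral_sub (hc2.integrable (by norm_num))
      ((hint.sub (integrable_const (cov P Ψ))).apply_continuousLinearMap h)
    refine h3.trans ?_
    simp only [Pi.sub_apply]
    rw [h1, h2, sub_zero]
  have hi : ∀ i, IdentDistrib (fun ω => g (Ψ i ω)) (fun ω => g (Ψ 0 ω)) P P :=
    fun i => (hident i).comp hg
  have hind : iIndepFun (fun i ω => g (Ψ i ω)) P := hindep.comp (fun _ => g) fun _ => hg
  have hsum (N : ℕ) ω : (√(N : ℝ))⁻¹ • ∑ k ∈ Finset.range N, g (Ψ k ω) =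
      √(N : ℝ) • ((sampleMean Ψ N ω - mean P Ψ)
        - (sampleCovTilde P Ψ N ω - cov P Ψ) h) := by
    rcases eq_or_ne N 0 with rfl | hN
    · simp
    have hN' : (N : ℝ) ≠ 0 := Nat.cast_ne_zero.2 hN
    have hsq : √(N : ℝ) * (N : ℝ)⁻¹ = (√(N : ℝ))⁻¹ := by
      rw [← div_eq_mul_inv, Real.sqrt_div_self', one_div]
    have hcov : (sampleCovTilde P Ψ N ω - cov P Ψ) h = (N : ℝ)⁻¹ • ∑ k ∈ Finset.range N,
        (rankOne ℝ (Ψ k ω - mean P Ψ) (Ψ k ω - mean P Ψ) - cov P Ψ) h := by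
      simp_rw [sampleCovTilde, sub_apply, Finset.sum_sub_distrib, smul_sub, smul_apply, sum_apply]
      rw [Finset.sum_const, Finset.card_range, ← Nat.cast_smul_eq_nsmul ℝ, inv_smul_smul₀ hN']
    rw [sampleMean_sub hN, hcov, ← smul_sub, smul_smul, hsq, ← Finset.sum_sub_distrib]
  have hclt := tendstoGaussian_inv_sqrt_smul_sum (X := fun i ω => g (Ψ i ω)) hX h0 hind hi
  have hint2 N := (memLp_inv_sqrt_smul_sum (X := fun i ω => g (Ψ i ω)) hX hi N).norm.integrable_sq
  have hle N := integral_norm_sq_inv_sqrt_smul_sum_le (X := fun i ω => g (Ψ i ω)) hX h0 hind hi N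
  simp_rw [hsum] at hclt hint2 hle
  exact ⟨fun N => ⟨hint2 N, hle N⟩, hclt⟩

end Fluctuation

/-! ### Linearization and asymptotic normality of the estimator. -/

section AsymptoticNormality

variable {Ω H : Type*} [MeasurableSpace Ω] {P : Measure Ω} [IsProbabilityMeasure P]
  [NormedAddCommGroup H] [InnerProductSpace ℝ H] [CompleteSpace H] {Ψ : ℕ → Ω → H} {lam : ℝ}

/-- Symmetry of `Σ_λ` passes to its inverse, which turns the image covariance `A Q A*` into `C_λ`.
-/
lemma adjoint_inverse_covReg (hΨ : MemLp (Ψ 0) 2 P) (hlam : 0 < lam) :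
    (Ring.inverse (covReg P Ψ lam)).adjoint = Ring.inverse (covReg P Ψ lam) := by
  have hc x : covReg P Ψ lam (Ring.inverse (covReg P Ψ lam) x) = x :=
    congrArg (· x) (Ring.mul_inverse_cancel _ (isUnit_of_coercive hlam (covReg_coercive hΨ lam)))
  refine ((ContinuousLinearMap.eq_adjoint_iff _ _).2 fun x y => ?_).symm
  set A := Ring.inverse (covReg P Ψ lam)
  calc inner ℝ (A x) y = inner ℝ (covReg P Ψ lam (A y)) (A x) := by
        rw [hc, real_inner_comm]
    _ = inner ℝ (covReg P Ψ lam (A x)) (A y) := covReg_symm hΨ lam _ _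
    _ = inner ℝ x (A y) := by rw [hc]

/-- The estimation error is the regularized sample inverse applied to a linear fluctuation term
and a quadratic remainder. -/
lemma estimator_sub_popSol (hΨ : MemLp (Ψ 0) 2 P) (hlam : 0 < lam) {N : ℕ} (hN : N ≠ 0) (ω : Ω) :
    estimator Ψ lam N ω - popSol P Ψ lam = Ring.inverse (sampleCovReg Ψ lam N ω)
      (((sampleMean Ψ N ω - mean P Ψ)
        - (sampleCovTilde P Ψ N ω - cov P Ψ) (popSol P Ψ lam))
        + inner ℝ (sampleMean Ψ N ω - mean P Ψ) (popSol P Ψ lam) •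
          (sampleMean Ψ N ω - mean P Ψ)) := by
  have hB x : Ring.inverse (sampleCovReg Ψ lam N ω) (sampleCovReg Ψ lam N ω x) = x :=
    congrArg (· x) (Ring.inverse_mul_cancel _
      (isUnit_of_coercive hlam (sampleCovReg_coercive Ψ lam N ω)))
  have hA : covReg P Ψ lam (popSol P Ψ lam) = mean P Ψ :=
    congrArg (· (mean P Ψ)) (Ring.mul_inverse_cancel _
      (isUnit_of_coercive hlam (covReg_coercive hΨ lam)))
  set h := popSol P Ψ lam
  -- Writing `h = Σ̂_λ⁻¹ Σ̂_λ h` turns the error into `Σ̂_λ⁻¹ (μ̂ - Σ̂_λ h)`; substituting `μ = Σ h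
  -- + λ h` then cancels the `λ` terms.
  conv_lhs => rw [estimator, ← hB h, ← map_sub]
  congr 1
  rw [covReg, add_apply] at hA
  rw [sampleCovReg, sampleCov_eq hN P]
  simp only [add_apply, sub_apply, rankOne_apply]
  nth_rewrite 3 [← hA]
  abel

/-- The resolvent identity, in which the `λ I` terms cancel. -/
lemma inverse_sub_inverse (hΨ : MemLp (Ψ 0) 2 P) (hlam : 0 < lam) (N : ℕ) (ω : Ω) :
    Ring.inverse (sampleCovReg Ψ lam N ω) - Ring.inverse (covReg P Ψ lam) =
      Ring.inverse (sampleCovReg Ψ lam N ω) * (cov P Ψ - sampleCov Ψ N ω) *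
        Ring.inverse (covReg P Ψ lam) := by
  have h1 := Ring.inverse_mul_cancel _
    (isUnit_of_coercive hlam (sampleCovReg_coercive Ψ lam N ω))
  have h2 := Ring.mul_inverse_cancel _ (isUnit_of_coercive hlam (covReg_coercive hΨ lam))
  have h3 : cov P Ψ - sampleCov Ψ N ω = covReg P Ψ lam - sampleCovReg Ψ lam N ω := by
    rw [covReg, sampleCovReg]; abel
  rw [h3, mul_sub, sub_mul, h1, one_mul, mul_assoc, h2, mul_one]

lemma norm_inverse_sub_inverse_apply_le (hΨ : MemLp (Ψ 0) 2 P) (hlam : 0 < lam) (N : ℕ) (ω : Ω)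
    (v : H) :
    ‖(Ring.inverse (sampleCovReg Ψ lam N ω) - Ring.inverse (covReg P Ψ lam)) v‖ ≤
      lam⁻¹ * ‖cov P Ψ - sampleCov Ψ N ω‖ * lam⁻¹ * ‖v‖ := by
  refine ContinuousLinearMap.le_of_opNorm_le _ ?_ v
  rw [inverse_sub_inverse hΨ hlam]
  refine (norm_mul_le _ _).trans (mul_le_mul ((norm_mul_le _ _).trans ?_)
    (norm_inverse_le_of_coercive hlam (covReg_coercive hΨ lam)) (norm_nonneg _) (by positivity))
  exact mul_le_mul_of_nonneg_right
    (norm_inverse_le_of_coercive hlam (sampleCovReg_coercive Ψ lam N ω)) (norm_nonneg _)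

variable [MeasurableSpace H] [BorelSpace H]

lemma integral_norm_sq_sqrt_smul_sampleMean_sub (hΨ : MemLp (Ψ 0) 2 P) (hindep : iIndepFun Ψ P)
    (hident : ∀ i, IdentDistrib (Ψ i) (Ψ 0) P P) (N : ℕ) :
    Integrable (fun ω => ‖√(N : ℝ) • (sampleMean Ψ N ω - mean P Ψ)‖ ^ 2) P ∧
      ∫ ω, ‖√(N : ℝ) • (sampleMean Ψ N ω - mean P Ψ)‖ ^ 2 ∂P ≤
        ∫ ω, ‖Ψ 0 ω - mean P Ψ‖ ^ 2 ∂P := by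
  have hg : Measurable fun x : H => x - mean P Ψ := measurable_id.sub_const _
  have hX : MemLp (fun ω => Ψ 0 ω - mean P Ψ) 2 P := hΨ.sub (memLp_const _)
  have hi : ∀ i, IdentDistrib (fun ω => Ψ i ω - mean P Ψ) (fun ω => Ψ 0 ω - mean P Ψ) P P :=
    fun i => (hident i).comp hg
  have h0 : ∫ ω, (Ψ 0 ω - mean P Ψ) ∂P = 0 := by
    rw [integral_sub (hΨ.integrable (by norm_num)) (integrable_const _)]
    simp [mean]
  have hsum ω : (√(N : ℝ))⁻¹ • ∑ k ∈ Finset.range N, (Ψ k ω - mean P Ψ) =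
      √(N : ℝ) • (sampleMean Ψ N ω - mean P Ψ) := by
    rcases eq_or_ne N 0 with rfl | hN
    · simp
    rw [sampleMean_sub hN, smul_smul, ← div_eq_mul_inv, Real.sqrt_div_self', one_div]
  have h1 := (memLp_inv_sqrt_smul_sum (X := fun i ω => Ψ i ω - mean P Ψ) hX hi N).norm.integrable_sq
  have h2 := integral_norm_sq_inv_sqrt_smul_sum_le (X := fun i ω => Ψ i ω - mean P Ψ) hX h0
    (hindep.comp (fun _ x => x - mean P Ψ) fun _ => hg) hi N
  simp_rw [hsum] at h1 h2
  exact ⟨h1, h2⟩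

variable [SecondCountableTopology H]

/-- Asymptotic normality of the estimator. -/
lemma tendstoGaussian_estimator (hΨ : MemLp (Ψ 0) 4 P) (hindep : iIndepFun Ψ P)
    (hident : ∀ i, IdentDistrib (Ψ i) (Ψ 0) P P) (hlam : 0 < lam) :
    TendstoGaussian P (fun (N : ℕ) ω => √(N : ℝ) • (estimator Ψ lam N ω - popSol P Ψ lam))
      (covLimit P Ψ lam) := by
  have hL2 : MemLp (Ψ 0) 2 P := hΨ.mono_exponent (by norm_num)
  have hm i : AEMeasurable (Ψ i) P := (hident i).aemeasurable_fst
  obtain ⟨hmom, hclt⟩ := tendstoGaussian_fluct hΨ hindep hident lam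
  set h := popSol P Ψ lam with hh
  set A := Ring.inverse (covReg P Ψ lam) with hA
  let B : ℕ → Ω → H →L[ℝ] H := fun N ω => Ring.inverse (sampleCovReg Ψ lam N ω)
  let V : ℕ → Ω → H := fun N ω => √(N : ℝ) • ((sampleMean Ψ N ω - mean P Ψ)
        - (sampleCovTilde P Ψ N ω - cov P Ψ) h)
  let δ : ℕ → Ω → H := fun N ω => sampleMean Ψ N ω - mean P Ψ
  have hlin := hclt.clm_comp A
  rw [hA, adjoint_inverse_covReg hL2 hlam] at hlin
  refine hlin.of_tendstoInMeasure_sub ?_ fun N =>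
    ((aemeasurable_estimator hm hlam N).sub_const _).const_smul √(N : ℝ)
  -- Cost of replacing the sample inverse by `A`: `Σ̂ → Σ` almost surely while `V` is bounded in
  -- `L²`.
  have h1 : TendstoInMeasure P (fun N ω => (B N ω - A) (V N ω)) atTop 0 := by
    refine tendstoInMeasure_zero_of_le_mul (V := V)
      (Z := fun N ω => lam⁻¹ * ‖cov P Ψ - sampleCov Ψ N ω‖ * lam⁻¹) (fun N => ?_) ?_
      (fun N => (hmom N).1) (fun N => (hmom N).2)
      (fun N ω => norm_inverse_sub_inverse_apply_le hL2 hlam N ω _)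
    · exact ((aestronglyMeasurable_const.sub
        (aestronglyMeasurable_sampleCov hm N)).norm.const_mul _).mul_const _
    · filter_upwards [tendsto_sampleCov hL2 hindep hident] with ω hω
      simpa using (((hω.const_sub (cov P Ψ)).norm).const_mul lam⁻¹).mul_const lam⁻¹
  -- Only one factor `δ` of the quadratic remainder absorbs `√N`; the other tends to `0` almost
  -- surely.
  have h2 : TendstoInMeasure P
      (fun N ω => inner ℝ (δ N ω) h • B N ω (√(N : ℝ) • δ N ω)) atTop 0 := by
    refine tendstoInMeasure_zero_of_le_mul (V := fun N ω => √(N : ℝ) • δ N ω)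
      (Z := fun N ω => ‖δ N ω‖ * ‖h‖ * lam⁻¹) (fun N => ?_) ?_
      (fun N => (integral_norm_sq_sqrt_smul_sampleMean_sub hL2 hindep hident N).1)
      (fun N => (integral_norm_sq_sqrt_smul_sampleMean_sub hL2 hindep hident N).2)
      (fun N ω => ?_)
    · exact (((aemeasurable_sampleMean hm N).aestronglyMeasurable.sub
        aestronglyMeasurable_const).norm.mul_const _).mul_const _
    · filter_upwards [tendsto_sampleMean hL2 hindep hident] with ω hω
      simpa [δ] using (((hω.sub_const (mean P Ψ)).norm).mul_const ‖h‖).mul_const lam⁻¹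
    · rw [norm_smul, mul_assoc (‖δ N ω‖ * ‖h‖)]
      refine mul_le_mul (norm_inner_le_norm _ _) (ContinuousLinearMap.le_of_opNorm_le _ ?_ _)
        (norm_nonneg _) (by positivity)
      exact norm_inverse_le_of_coercive hlam (sampleCovReg_coercive Ψ lam N ω)
  convert tendstoInMeasure_zero_add h1 h2 using 1
  ext N ω
  -- The error identity is available only for `N ≠ 0`; at `N = 0` every term carries `√0 = 0`.
  rcases eq_or_ne N 0 with rfl | hN
  · simp [V]
  have hsplit : √(N : ℝ) • (estimator Ψ lam N ω - h) =
      B N ω (V N ω) + inner ℝ (δ N ω) h • B N ω (√(N : ℝ) • δ N ω) := by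
    rw [hh, estimator_sub_popSol hL2 hlam hN, ← hh]
    simp only [V, B, δ, map_add, map_smul, smul_add]
    rw [smul_comm √(N : ℝ) (inner ℝ _ h)]
  change √(N : ℝ) • (estimator Ψ lam N ω - h) - A (V N ω) = (B N ω (V N ω) - A (V N ω)) +
    inner ℝ (δ N ω) h • B N ω (√(N : ℝ) • δ N ω)
  rw [hsplit]
  abel

end AsymptoticNormality

end MeanVariance

theorem mainTheorem2
    {d s : ℕ} {X : Set (EuclideanSpace ℝ (Fin d))} {Y : Set ℝ}
    -- derivatives on `X` are uniquely determined (e.g. `X` open); nothing is needed if `s = 0`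
    (hX : 0 < s → UniqueDiffOn ℝ X)
    (K : EuclideanSpace ℝ (Fin d) → EuclideanSpace ℝ (Fin d) → ℝ)
    (hK : ContDiffOn ℝ ((2 * s : ℕ) : WithTop ℕ∞) (fun p => K p.1 p.2) (X ×ˢ X))
    -- `H` is the separable RKHS on `X` with reproducing kernel `K`
    {H : Type*} [NormedAddCommGroup H] [InnerProductSpace ℝ H] [CompleteSpace H]
    [TopologicalSpace.SeparableSpace H] [MeasurableSpace H] [BorelSpace H]
    [RKHS ℝ H X ℝ] (hKH : ∀ x y : X, RKHS.kerFun H x (1 : ℝ) y = K x y)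
    (w : (Fin d → ℕ) → X × Y → ℝ)
    {Ω : Type*} [MeasurableSpace Ω] (P : Measure Ω) [IsProbabilityMeasure P]
    -- the observations, and the i.i.d. random vectors `ψ i = ψ(z i)`
    (z : ℕ → Ω → X × Y) (ψ : ℕ → Ω → H)
    (hψ : ∀ i ω, ψ i ω = MeanVariance.psi H s K w (z i ω))
    (hindep : iIndepFun ψ P) (hident : ∀ i, IdentDistrib (ψ i) (ψ 0) P P)
    (hmoment : Integrable (fun ω => ‖ψ 0 ω‖ ^ 4) P)
    (lam : ℝ) (hlam : 0 < lam) :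
    -- `Σ_λ` and `Σ̂_λ` are invertible, and `h_λ`, `ĥ_λ` are the unique minimizers
    (IsUnit (MeanVariance.covReg P ψ lam) ∧
      (∀ N ω, IsUnit (MeanVariance.sampleCovReg ψ lam N ω)) ∧
      (∀ g : H, IsMinOn (MeanVariance.objective P ψ lam) Set.univ g ↔
        g = MeanVariance.popSol P ψ lam) ∧
      (∀ N ω, ∀ g : H, IsMinOn (MeanVariance.sampleObjective ψ lam N ω) Set.univ g ↔
        g = MeanVariance.estimator ψ lam N ω)) ∧
    -- almost sure convergence of the estimator
    (∀ᵐ ω ∂P, Tendsto (fun N => MeanVariance.estimator ψ lam N ω) atTop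
      (𝓝 (MeanVariance.popSol P ψ lam))) ∧
    -- asymptotic normality of the estimator
    MeanVariance.TendstoGaussian P
      (fun N ω => √(N : ℝ) • (MeanVariance.estimator ψ lam N ω - MeanVariance.popSol P ψ lam))
      (MeanVariance.covLimit P ψ lam) ∧
    -- central limit theorem for the main fluctuation term
    MeanVariance.TendstoGaussian P
      (fun N ω => √(N : ℝ) • ((MeanVariance.sampleMean ψ N ω - MeanVariance.mean P ψ)
        - (MeanVariance.sampleCovTilde P ψ N ω - MeanVariance.cov P ψ)
            (MeanVariance.popSol P ψ lam)))
      (MeanVariance.covQ P ψ lam) := by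
  have : SecondCountableTopology H := UniformSpace.secondCountable_of_separable H
  have h4 : MemLp (ψ 0) 4 P := by
    have hm := (hident 0).aemeasurable_fst.aestronglyMeasurable
    rw [← memLp_norm_rpow_iff (q := 4) hm (by norm_num) (by norm_num),
      ENNReal.div_self (by norm_num) (by norm_num), memLp_one_iff_integrable]
    exact_mod_cast hmoment
  have h2 : MemLp (ψ 0) 2 P := h4.mono_exponent (by norm_num)
  exact ⟨⟨MeanVariance.isUnit_of_coercive hlam (MeanVariance.covReg_coercive h2 lam),
      fun N ω => MeanVariance.isUnit_of_coercive hlam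
        (MeanVariance.sampleCovReg_coercive ψ lam N ω),
      MeanVariance.isMinOn_objective_iff h2 hlam,
      MeanVariance.isMinOn_sampleObjective_iff ψ hlam⟩,
    MeanVariance.tendsto_estimator h2 hindep hident hlam,
    MeanVariance.tendstoGaussian_estimator h4 hindep hident hlam,
    (MeanVariance.tendstoGaussian_fluct h4 hindep hident lam).2⟩
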